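/- Theorem (Back-door adjustment at a frequency). Let $V=\{1,\dots,n\}$, let $(\Theta,\mathcal F,\mathbb P)$ be a probability space, and let $\mathbf X_1,\dots,\mathbf X_n$ be real stochastic processes on it, indexed by a set $I\subseteq\mathbb Z$, with absolutely summable sample paths. Fix $\omega\in[0,2\pi]$ and put $\widehat X_i(\omega)=\sum_{t\in I}X_i(t)e^{-\mathrm i\omega t}$. Suppose that the random vector $(\widehat X_1(\omega),\dots,\widehat X_n(\omega))\in\mathbb C^n$ has a density $f=f^{(\omega)}$ with respect to a product $\nu=\bigotimes_i\nu_i$ of $\sigma$-finite measures on $\mathbb C$. For $A,B\subseteq V$ write $f(x_A)$ for the marginal density (integrate out $x_{V\setminus A}$) and $f(x_A\mid x_B)=f(x_A,x_B)/f(x_B)$ for the conditional density. Let $G=G^{(\omega)}$ be a directed acyclic graph on $V$ according to which $f$ factorizes: $f(x)=\prod_{k\in V}f(x_k\mid x_{Pa_k})$ for $\nu$-almost every $x$, where $Pa_k$ is the set of parents of $k$ and $f(x_k\mid x_{Pa_k})$ denotes a regular version of the conditional density (jointly measurable, of integral one in $x_k$ for every value of $x_{Pa_k}$). For disjoint $W,Y\subseteq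 V$ the causal effect of $W$ on $Y$ is given by the truncated factorization $$f^{(\omega)}(y\mid do(W=w))=\int\prod_{k\in V\setminus W}f(x_k\mid x_{Pa_k})\,d\nu(x_{V\setminus(W\cup Y)}),\qquad x_W=w,\ x_Y=y .$$ Let $W,Y,Z\subseteq V$ be pairwise disjoint and let $Z$ satisfy the back-door criterion relative to $(W,Y)$: no node of $Z$ is a descendant of a node of $W$, and $Z$ blocks every path (without repeated nodes, in the skeleton of $G$) from a node $w\in W$ to a node of $Y$ whose first edge is an arrow into $w$. Here $Z$ blocks a path if the path has an interior non-collider that belongs to $Z$, or a collider such that neither it nor any of its descendants belongs to $Z$. Call a value $w$ of $x_W$ admissible if $f(w,z)>0$ for almost every $z$ with $f(z)>0$. Then the causal effect of $W$ on $Y$ at admissible values is identifiable from the density of $(W,Y,Z)$: any two densities, with conditional densities, that factorize according to $G$ and have the same marginal density of $(x_W,x_Y,x_Z)$ as $f$ have the same $f^{(\omega)}(y\mid do(W=w))$ for almost every $(w,y)$ with $w$ admissible. Moreover, for almost every $(w,y)$ with $w$ admissible, $$f^{(\omega)}(y\mid do(W=w))=\int f^{(\omega)}(y\mid w,z)\,f^{(\omega)}(z)\,d\nu(z).$$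 -/

import Mathlib

open MeasureTheory
open scoped ENNReal

noncomputable section

namespace FreqBackdoor

/-! ### Fourier components of stochastic processes -/

/-- The discrete time Fourier transform at frequency `ω` of the sample path at `θ` of a real
stochastic process `X` with time index set `I ⊆ ℤ`. -/
def fourierComponent {Θ : Type*} {I : Set ℤ} (X : I → Θ → ℝ) (ω : ℝ) (θ : Θ) : ℂ :=
  ∑' t : I, (X t θ : ℂ) * Complex.exp (-(Complex.I * (ω : ℂ) * ((t : ℤ) : ℂ)))

/-! ### Directed graphs, paths, blocking, the back-door criterion -/

section Graph

variable {V : Type*}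

/-- A directed graph is acyclic (a DAG) if it has no directed cycle. -/
def IsDAG (G : Digraph V) : Prop := ∀ v, ¬ Relation.TransGen G.Adj v v

/-- `v` is a descendant of `u`: there is a directed path (with at least one edge) from `u`
to `v`. -/
def IsDescendant (G : Digraph V) (u v : V) : Prop := Relation.TransGen G.Adj u v

open Classical in
/-- The set of parents of a node. -/
def parents [Fintype V] (G : Digraph V) (k : V) : Finset V :=
  Finset.univ.filter fun j => G.Adj j k

/-- A path in the topology (the skeleton) of `G`, given by the list of the nodes it visits:
consecutive nodes are joined by an edge in one of the directions, and no node is repeated. -/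
def IsPath (G : Digraph V) (p : List V) : Prop :=
  p.Nodup ∧ p.IsChain fun a b => G.Adj a b ∨ G.Adj b a

/-- A path from `w` to `y` whose first edge is an arrow into `w`. -/
def IsBackdoorPath (G : Digraph V) (w y : V) (p : List V) : Prop :=
  IsPath G p ∧ p.getLast? = some y ∧ ∃ v rest, p = w :: v :: rest ∧ G.Adj v w

/-- `a → c ← b`: the node `c` is a collider between the neighbours `a` and `b`. -/
def IsCollider (G : Digraph V) (a c b : V) : Prop := G.Adj a c ∧ G.Adj b c

/-- `Z` blocks the path `p`: either `p` has an interior non-collider that belongs to `Z`, or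
`p` has a collider such that neither it nor any of its descendants belongs to `Z`. -/
def Blocks (G : Digraph V) (Z : Finset V) (p : List V) : Prop :=
  ∃ a c b, [a, c, b] <:+: p ∧
    ((¬ IsCollider G a c b ∧ c ∈ Z) ∨
      (IsCollider G a c b ∧ c ∉ Z ∧ ∀ d, IsDescendant G c d → d ∉ Z))

/-- `Z` satisfies the back-door criterion relative to the ordered pair `(W, Y)`. -/
structure BackdoorCriterion (G : Digraph V) (W Y Z : Finset V) : Prop where
  not_descendant : ∀ w ∈ W, ∀ z ∈ Z, ¬ IsDescendant G w z
  blocks : ∀ w ∈ W, ∀ y ∈ Y, ∀ p, IsBackdoorPath G w y p → Blocks G Z p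

end Graph

/-! ### Densities

All densities are taken with respect to a product reference measure `∏ i, ν i` on the space
`V → ℂ` of configurations. A density of the variables in `A ⊆ V` is written as a function of
the whole configuration `x` that only depends on the coordinates `x i`, `i ∈ A`. -/

section Density

variable {V : Type*} [Fintype V] [DecidableEq V]

/-- The marginal density `f(x_A) = ∫ f(x) dν(x_{V ∖ A})`. -/
def marginalDensity (ν : V → Measure ℂ) (f : (V → ℂ) → ℝ≥0∞) (A : Finset V) :
    (V → ℂ) → ℝ≥0∞ :=
  lmarginal ν Aᶜ f

/-- The conditional density `f(x_A ∣ x_B) = f(x_A, x_B) / f(x_B)`. -/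
def condDensity (ν : V → Measure ℂ) (f : (V → ℂ) → ℝ≥0∞) (A B : Finset V) (x : V → ℂ) :
    ℝ≥0∞ :=
  marginalDensity ν f (A ∪ B) x / marginalDensity ν f B x

/-- `q` is a (regular) version of the conditional density `f(x_k ∣ x_B)` of the `k`-th variable
given the variables in `B`: a jointly measurable function of `(x_k, x_B)` which is a probability
density in `x_k` for every value of `x_B`, and with `q(x_k, x_B) f(x_B) = f(x_k, x_B)` almost
everywhere. -/
structure IsCondDensity (ν : V → Measure ℂ) (f : (V → ℂ) → ℝ≥0∞) (k : V) (B : Finset V)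
    (q : (V → ℂ) → ℝ≥0∞) : Prop where
  measurable : Measurable q
  dependsOn : DependsOn q (({k} ∪ B : Finset V) : Set V)
  normalized : ∀ x, lmarginal ν {k} q x = 1
  bayes : ∀ᵐ x ∂Measure.pi ν,
    q x * marginalDensity ν f B x = marginalDensity ν f ({k} ∪ B) x

/-- The density `f` factorizes according to `G`, `f(x) = ∏ k, f(x_k ∣ x_{Pa k})`, where `q k`
is the version of the conditional density `f(x_k ∣ x_{Pa k})` that is used. -/
structure Factorizes (G : Digraph V) (ν : V → Measure ℂ) (f : (V → ℂ) → ℝ≥0∞)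
    (q : V → (V → ℂ) → ℝ≥0∞) : Prop where
  measurable : Measurable f
  isCondDensity : ∀ k, IsCondDensity ν f k (parents G k) (q k)
  factorization : ∀ᵐ x ∂Measure.pi ν, f x = ∏ k, q k x

/-- The intervened joint density of the variables outside `W` under `do(W = w)`, at `w = x_W`:
the factors of the nodes in `W` are removed from the factorization. -/
def interventionDensity (q : V → (V → ℂ) → ℝ≥0∞) (W : Finset V) (x : V → ℂ) : ℝ≥0∞ :=
  ∏ k ∈ Wᶜ, q k x

/-- The causal effect `f(y ∣ do(W = w))` at `w = x_W` and `y = x_Y`, for `Y` disjoint from `W`: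
all variables outside `W ∪ Y` are integrated out of the intervened joint density. -/
def doDensity (ν : V → Measure ℂ) (q : V → (V → ℂ) → ℝ≥0∞) (W Y : Finset V) :
    (V → ℂ) → ℝ≥0∞ :=
  lmarginal ν (W ∪ Y)ᶜ (interventionDensity q W)

/-- Positivity at the value `w = x_W`: `f(w, z) > 0` for almost every `z` with `f(z) > 0`, so
that `f(y ∣ w, z)` is defined for almost every relevant `z`. -/
def Positivity (ν : V → Measure ℂ) (f : (V → ℂ) → ℝ≥0∞) (W Z : Finset V) (x : V → ℂ) :
    Prop :=
  ∀ᵐ z ∂Measure.pi (fun i : Z => ν i),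
    0 < marginalDensity ν f Z (Function.updateFinset x Z z) →
      0 < marginalDensity ν f (W ∪ Z) (Function.updateFinset x Z z)

/-- The causal effect of `W` on `Y` is identifiable from the observed variables `O`, for
interventions at the values `x_W` admitted by `A`: in any two models that are compatible with
`G` and have the same density of the observed variables as `f`, it is the same. -/
def Identifiable (G : Digraph V) (ν : V → Measure ℂ) (f : (V → ℂ) → ℝ≥0∞)
    (O W Y : Finset V) (A : (V → ℂ) → Prop) : Prop :=
  ∀ (f₁ f₂ : (V → ℂ) → ℝ≥0∞) (q₁ q₂ : V → (V → ℂ) → ℝ≥0∞),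
    Factorizes G ν f₁ q₁ → Factorizes G ν f₂ q₂ →
    marginalDensity ν f₁ O =ᵐ[Measure.pi ν] marginalDensity ν f O →
    marginalDensity ν f₂ O =ᵐ[Measure.pi ν] marginalDensity ν f O →
    ∀ᵐ x ∂Measure.pi ν, A x → doDensity ν q₁ W Y x = doDensity ν q₂ W Y x

end Density

end FreqBackdoor

end

/-! The argument uses the kernels `q k`, each of mass one in its own variable: integrating out a
sink deletes its factor, so only the factors of A, the ancestral closure of W ∪ Y ∪ Z, matter.

Let R be the nodes of A outside W ∪ Z that are reached from W by an `ActiveWalk`, which leaves W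
against an arrow. If k ∈ A lies in W or its scope {k} ∪ Pa k meets R, the scope lies in R ∪ W ∪ Z:
two members of a scope are adjacent or joined by the collider k, which is open as k ∈ A
(`exists_separation`). The back-door criterion keeps Y out of R (`not_activeWalk`): colliders
outside the ancestral closure of Z can be bypassed, and loops can be cut, so an active walk to Y
would yield an unblocked back-door path.

Every density of A then splits into a product a whose scopes avoid R and a product supported on R ∪
W ∪ Z. Only the second changes under do(W = w), and only the first involves y. Comparing integrals
gives f(y,w,z) f(z ∣ do(w)) = f(w,z) f(y,z ∣ do(w)) at every point, without division
(`backdoor_mul_eq`). Moreover f(z ∣ do(w)) = f(z), since no ancestor of Z lies in W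
(`lmarginal_interventionDensity`). Dividing by f(w,z) and integrating over z gives the formula; its
right side depends only on the density of (W, Y, Z), hence identifiability. -/

namespace FreqBackdoor

/-! ### Active walks and the rerouting of colliders -/

section Graph

variable {V : Type*} {G : Digraph V} {W Y Z : Finset V}

/-- The ancestral closure of `S`: the nodes of `S` and their ancestors. -/
def ancestralSet (G : Digraph V) (S : Finset V) : Set V :=
  {c | ∃ d ∈ S, Relation.ReflTransGen G.Adj c d}

theorem subset_ancestralSet {S : Finset V} {c : V} (h : c ∈ S) : c ∈ ancestralSet G S :=
  ⟨c, h, .refl⟩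

theorem ancestralSet_of_adj {S : Finset V} {a c : V} (h : G.Adj a c)
    (hc : c ∈ ancestralSet G S) : a ∈ ancestralSet G S := by
  obtain ⟨d, hd, hcd⟩ := hc
  exact ⟨d, hd, .head h hcd⟩

theorem IsDAG.asymm (hG : IsDAG G) {a b : V} (h : G.Adj a b) : ¬ G.Adj b a :=
  fun h' => hG a (.tail (.single h) h')

/-- The interior node `c` between `a` and `b` is open: a collider has to belong to `C`, a
non-collider must not belong to `W ∪ Z`. -/
def IsOpen (G : Digraph V) (W Z : Finset V) (C : Set V) (a c b : V) : Prop :=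
  (IsCollider G a c b → c ∈ C) ∧ (¬ IsCollider G a c b → c ∉ W ∧ c ∉ Z)

/-- There is a walk with last edge between `b` and `c` which starts in `W` with an arrow into its
starting node, and all of whose interior nodes are open. -/
inductive ActiveWalk (G : Digraph V) (W Z : Finset V) (C : Set V) : V → V → Prop
  | base {w v : V} : w ∈ W → G.Adj v w → ActiveWalk G W Z C w v
  | step {b c a : V} : ActiveWalk G W Z C b c → (G.Adj a c ∨ G.Adj c a) →
      IsOpen G W Z C b c a → ActiveWalk G W Z C c a

/-- A node `c` with a directed path to `W ∪ Y`, but none to `Z`, belongs to `W`, or prolongs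
active walks to `Y`, or is reached from `W` by an active walk against the arrows. -/
theorem ActiveWalk.reroute (hG : IsDAG G) {C : Set V} {c t : V} (ht : t ∈ W ∨ t ∈ Y)
    (hct : Relation.ReflTransGen G.Adj c t) (hc : c ∉ ancestralSet G Z) :
    (∀ b, ActiveWalk G W Z C b c → ∃ b', ∃ y ∈ Y, ActiveWalk G W Z C b' y) ∨ c ∈ W ∨
      ∃ b, G.Adj c b ∧ ActiveWalk G W Z C b c := by
  induction hct using Relation.ReflTransGen.head_induction_on with
  | refl =>
    rcases ht with ht | ht
    · exact .inr (.inl ht)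
    · exact .inl fun b hb => ⟨b, t, ht, hb⟩
  | @head a c hac hct ih =>
    by_cases haW : a ∈ W
    · exact .inr (.inl haW)
    have haZ : a ∉ Z := fun h => hc (subset_ancestralSet h)
    have hcZ : c ∉ ancestralSet G Z := fun h => hc (ancestralSet_of_adj hac h)
    by_cases hcW : c ∈ W
    -- The arrow a → c into W starts a fresh walk.
    · exact .inr (.inr ⟨c, hac, .base hcW hac⟩)
    rcases ih hcZ with h | h | ⟨b, hcb, hb⟩
    · refine .inl fun b hb => h a (hb.step (.inr hac) ⟨fun h => ?_, fun _ => ⟨haW, haZ⟩⟩)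
      exact absurd h.2 (hG.asymm hac)
    · exact absurd h hcW
    · refine .inr (.inr ⟨c, hac, hb.step (.inl hac) ⟨fun h => ?_, fun _ => ⟨hcW, fun h => ?_⟩⟩⟩)
      · exact absurd h.1 (hG.asymm hcb)
      · exact hcZ (subset_ancestralSet h)

/-- Colliders that are ancestors of `W ∪ Y`, but not of `Z`, can be avoided. -/
theorem ActiveWalk.colliders_subset (hG : IsDAG G) {b c : V} [DecidableEq V]
    (h : ActiveWalk G W Z (ancestralSet G (W ∪ Y ∪ Z)) b c) :
    ActiveWalk G W Z (ancestralSet G Z) b c ∨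
      ∃ b', ∃ y ∈ Y, ActiveWalk G W Z (ancestralSet G Z) b' y := by
  induction h with
  | base hw hv => exact .inl (.base hw hv)
  | @step b c a h hca ho ih =>
    rcases ih with ih | ih
    swap
    · exact .inr ih
    by_cases hcol : IsCollider G b c a
    swap
    · exact .inl (ih.step hca ⟨fun h => absurd h hcol, ho.2⟩)
    by_cases hcZ : c ∈ ancestralSet G Z
    · exact .inl (ih.step hca ⟨fun _ => hcZ, fun h => absurd hcol h⟩)
    obtain ⟨t, ht, hct⟩ := ho.1 hcol
    have ht' : t ∈ W ∨ t ∈ Y := by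
      simp only [Finset.mem_union] at ht
      rcases ht with ht | ht
      · exact ht
      · exact absurd ⟨t, ht, hct⟩ hcZ
    -- A collider in W can be made the new start: the arrow from the next node enters it.
    by_cases hcW : c ∈ W
    · exact .inl (.base hcW hcol.2)
    -- Either the walk follows the arrows down from c to Y, or a new walk climbs to c from W,
    -- leaving c a non-collider.
    rcases ActiveWalk.reroute hG ht' hct hcZ with h | h | ⟨b', hcb, hb⟩
    · exact .inr (h b ih)
    · exact absurd h hcW
    · refine .inl (hb.step hca ⟨fun h => absurd h.1 (hG.asymm hcb), fun _ => ⟨hcW, fun h => ?_⟩⟩)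
      exact hcZ (subset_ancestralSet h)

/-! ### Cutting loops: from active walks to paths -/

/-- `OpenExt q a`: the open path `q`, listed from its last node to its first node, can be prolonged
by the node `a`. -/
def OpenExt (G : Digraph V) (W Z : Finset V) (C : Set V) : List V → V → Prop
  | [], _ => False
  | [w], a => G.Adj a w
  | c :: b :: _, a => (G.Adj a c ∨ G.Adj c a) ∧ IsOpen G W Z C b c a

/-- Paths without repeated nodes that start in `W` with an arrow into the starting node and all of
whose interior nodes are open, listed from the last node to the first node. -/
inductive OpenPath (G : Digraph V) (W Z : Finset V) (C : Set V) : List V → Prop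
  | single {w : V} : w ∈ W → OpenPath G W Z C [w]
  | cons {q : List V} {a : V} : OpenPath G W Z C q → OpenExt G W Z C q a → a ∉ q →
      OpenPath G W Z C (a :: q)

theorem OpenPath.of_suffix {C : Set V} {q r : List V} (hq : OpenPath G W Z C q) (hr : r ≠ [])
    (h : r <:+ q) : OpenPath G W Z C r := by
  induction hq with
  | @single w hw =>
    rcases List.suffix_cons_iff.1 h with rfl | h
    · exact .single hw
    · exact absurd (List.suffix_nil.1 h) hr
  | @cons q a hq ha haq ih =>
    rcases List.suffix_cons_iff.1 h with rfl | h
    · exact .cons hq ha haq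
    · exact ih h

/-- If an open path returns towards one of its nodes `a` against an arrow out of `a`, and it had
left `a` along an arrow out of `a`, then there is a collider in between. -/
theorem OpenPath.mem_of_loop {C : Set V}
    (hC : ∀ a c, G.Adj a c → c ∈ C → a ∈ C) {l r : List V} {a c e x : V} :
    ∀ {q : List V}, c :: q = l ++ e :: a :: r → OpenPath G W Z C (c :: q) →
      OpenExt G W Z C (c :: q) x → G.Adj x c → G.Adj a e → c ∈ C := by
  induction l generalizing c x with
  | nil =>
    intro q h hq hx hxc hae
    obtain ⟨rfl, rfl⟩ := List.cons.inj h
    exact hx.2.1 ⟨hae, hxc⟩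
  | cons c' l ih =>
    intro q h hq hx hxc hae
    obtain ⟨rfl, rfl : q = l ++ e :: a :: r⟩ := List.cons.inj h
    obtain ⟨b, q, hbq⟩ : ∃ b q, l ++ e :: a :: r = b :: q := by cases l <;> simp
    rw [hbq] at hq hx
    cases hq with
    | cons hq hc _ =>
    -- Either c is an open collider b → c ← x, or c → b and the argument continues at b, with c a
    -- parent of a node of C.
    by_cases hbc : G.Adj b c
    · exact hx.2.1 ⟨hbc, hxc⟩
    · have hcb : G.Adj c b := by
        cases q with
        | nil => exact hc
        | cons => exact hc.1.resolve_right hbc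
      exact hC c b hcb (ih hbq.symm hq hc hcb hae)

/-- An active walk can be shortened to an open path without repeated nodes. -/
theorem ActiveWalk.exists_openPath (hG : IsDAG G) {C : Set V}
    (hC : ∀ a c, G.Adj a c → c ∈ C → a ∈ C) {b c : V} (h : ActiveWalk G W Z C b c) :
    ∃ q, OpenPath G W Z C (c :: q) ∧
      ∀ a, (G.Adj a c ∨ G.Adj c a) → IsOpen G W Z C b c a → OpenExt G W Z C (c :: q) a := by
  induction h with
  | @base w v hw hv =>
    refine ⟨[w], .cons (.single hw) hv ?_, fun a ha ho => ⟨ha, ho⟩⟩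
    simp only [List.mem_singleton]
    rintro rfl
    exact hG.asymm hv hv
  | @step b c a _ hca ho ih =>
    obtain ⟨q, hq, hext⟩ := ih
    have hqa := hext a hca ho
    by_cases haq : a ∈ c :: q
    swap
    · exact ⟨c :: q, .cons hq hqa haq, fun d hd hod => ⟨hd, hod⟩⟩
    obtain ⟨l, r, hlr⟩ := List.append_of_mem haq
    have har : OpenPath G W Z C (a :: r) := hq.of_suffix (by simp) ⟨l, hlr.symm⟩
    -- Cut the loop at a. It remains to see that a is open between its old predecessor and d,
    -- knowing this for c, a, d on the walk and for the old predecessor, a, e on the path.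
    refine ⟨r, har, fun d hd hod => ?_⟩
    have hac : a ≠ c := by
      rintro rfl
      rcases hca with h | h <;> exact hG.asymm h h
    obtain ⟨l, e, rfl⟩ : ∃ l' e, l = l' ++ [e] := by
      rcases List.eq_nil_or_concat l with rfl | ⟨l', e, h⟩
      · exact absurd (List.cons.inj hlr).1.symm hac
      · exact ⟨l', e, by simpa using h⟩
    rw [List.append_assoc, List.singleton_append] at hlr
    have hear : OpenPath G W Z C (e :: a :: r) := hq.of_suffix (by simp) ⟨l, hlr.symm⟩
    cases hear with
    | cons _ he _ =>
    cases r with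
    -- Here a is the start, so a ∈ W; open on the walk, it must be a collider there, so d → a.
    | nil =>
      cases har with
      | single haW =>
        by_contra hda
        exact (hod.2 fun h => hda h.2).1 haW
      | cons h => cases h
    | cons b' r =>
      refine ⟨hd, fun hcol => ?_, fun hcol => ?_⟩
      -- A new collider at a was a collider on the walk or on the path, unless a → c and a → e; then
      -- the loop leaves and re-enters along arrows out of a and contains a collider below a.
      · by_cases hca' : G.Adj c a
        · exact hod.1 ⟨hca', hcol.2⟩
        have hac' := hca.resolve_right hca'
        by_cases hea : G.Adj e a
        · exact he.2.1 ⟨hcol.1, hea⟩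
        · exact hC a c hac' (hq.mem_of_loop hC hlr hqa hac' (he.1.resolve_left hea))
      · by_cases hcol' : IsCollider G b' a e
        · exact hod.2 fun h => hcol ⟨hcol'.1, h.2⟩
        · exact he.2.2 hcol'

theorem OpenPath.nodup {C : Set V} {q : List V} (h : OpenPath G W Z C q) : q.Nodup := by
  induction h with
  | single => simp
  | cons _ _ ha ih => exact List.nodup_cons.2 ⟨ha, ih⟩

theorem OpenPath.isChain {C : Set V} {q : List V} (h : OpenPath G W Z C q) :
    q.IsChain fun a b => G.Adj a b ∨ G.Adj b a := by
  induction h with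
  | single => simp
  | @cons q a _ ha _ ih =>
    match q, ha, ih with
    | [w], ha, _ => exact List.isChain_pair.2 (.inl ha)
    | c :: b :: q, ha, ih => exact List.isChain_cons_cons.2 ⟨ha.1, ih⟩

theorem OpenPath.exists_start {C : Set V} {q : List V} (h : OpenPath G W Z C q) :
    ∃ w ∈ W, q = [w] ∨ ∃ l v, q = l ++ [v, w] ∧ G.Adj v w := by
  induction h with
  | @single w hw => exact ⟨w, hw, .inl rfl⟩
  | @cons q a _ ha _ ih =>
    obtain ⟨w, hw, rfl | ⟨l, v, rfl, hv⟩⟩ := ih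
    · exact ⟨w, hw, .inr ⟨[], a, rfl, ha⟩⟩
    · exact ⟨w, hw, .inr ⟨a :: l, v, rfl, hv⟩⟩

theorem OpenPath.isOpen {C : Set V} {q : List V} (h : OpenPath G W Z C q) {a c b : V}
    (hacb : [a, c, b] <:+: q) : IsOpen G W Z C b c a := by
  induction h with
  | single => exact absurd hacb.length_le (by simp)
  | @cons q a' _ ha _ ih =>
    rcases List.infix_cons_iff.1 hacb with h | h
    · obtain ⟨r, hr⟩ := h
      simp only [List.cons_append, List.nil_append, List.cons.injEq] at hr
      obtain ⟨rfl, rfl⟩ := hr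
      exact ha.2
    · exact ih h

theorem OpenPath.not_blocks {q : List V} (h : OpenPath G W Z (ancestralSet G Z) q) :
    ¬ Blocks G Z q.reverse := by
  rintro ⟨a, c, b, hacb, hbl⟩
  have hi : [b, c, a] <:+: q := by simpa using List.reverse_infix.2 hacb
  have ho := h.isOpen hi
  rcases hbl with ⟨hn, hc⟩ | ⟨hcol, hc, hd⟩
  · exact (ho.2 hn).2 hc
  · obtain ⟨d, hdZ, hcd⟩ := ho.1 hcol
    rcases Relation.reflTransGen_iff_eq_or_transGen.1 hcd with rfl | hcd
    · exact hc hdZ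
    · exact hd d hcd hdZ

/-- Under the back-door criterion no active walk from `W` ends in `Y`. -/
theorem BackdoorCriterion.not_activeWalk (hG : IsDAG G) [DecidableEq V]
    (h : BackdoorCriterion G W Y Z) (hWY : Disjoint W Y) {b y : V} (hy : y ∈ Y) :
    ¬ ActiveWalk G W Z (ancestralSet G (W ∪ Y ∪ Z)) b y := by
  intro hwalk
  obtain ⟨b, y, hy, hwalk⟩ : ∃ b, ∃ y ∈ Y, ActiveWalk G W Z (ancestralSet G Z) b y := by
    rcases hwalk.colliders_subset hG with h | h
    · exact ⟨b, y, hy, h⟩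
    · exact h
  obtain ⟨q, hq, -⟩ := hwalk.exists_openPath hG fun _ _ => ancestralSet_of_adj
  obtain ⟨w, hw, hqw | ⟨l, v, hlv, hv⟩⟩ := hq.exists_start
  · obtain ⟨rfl, -⟩ := List.cons.inj hqw
    exact Finset.disjoint_left.1 hWY hw hy
  · refine hq.not_blocks (h.blocks w hw y hy _ ⟨⟨List.nodup_reverse.2 hq.nodup, ?_⟩, ?_, ?_⟩)
    · rw [List.isChain_reverse]
      exact hq.isChain.imp fun _ _ => Or.symm
    · simp
    · exact ⟨v, l.reverse, by simp [hlv], hv⟩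

/-! ### The separating set -/

/-- The set `R` of the nodes reached by active walks from `W` separates the factors attached to `W`
from `Y` given `W ∪ Z`: if the scope `{k} ∪ Pa k` of the factor of an ancestor `k` of `W ∪ Y ∪ Z`
meets `R`, or if `k ∈ W`, then this scope is contained in `R ∪ W ∪ Z`. -/
theorem BackdoorCriterion.exists_separation [Fintype V] [DecidableEq V] (hG : IsDAG G)
    (h : BackdoorCriterion G W Y Z) (hWY : Disjoint W Y) :
    ∃ R : Finset V, (∀ u ∈ R, u ∈ ancestralSet G (W ∪ Y ∪ Z)) ∧ Disjoint R (W ∪ Y ∪ Z) ∧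
      ∀ k ∈ ancestralSet G (W ∪ Y ∪ Z), (k ∈ W ∨ ¬ Disjoint ({k} ∪ parents G k) R) →
        {k} ∪ parents G k ⊆ R ∪ W ∪ Z := by
  classical
  set A := ancestralSet G (W ∪ Y ∪ Z) with hA
  let r : V → Prop := fun u => u ∈ A ∧ u ∉ W ∧ u ∉ Z ∧ ∃ b, ActiveWalk G W Z A b u
  have mem_scope : ∀ {k j}, j ∈ {k} ∪ parents G k ↔ j = k ∨ G.Adj j k := by
    simp [parents]
  have hadj : ∀ {u a}, r u → (G.Adj a u ∨ G.Adj u a) → ActiveWalk G W Z A u a :=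
    fun ⟨hu, huW, huZ, b, hb⟩ ha => hb.step ha ⟨fun _ => hu, fun _ => ⟨huW, huZ⟩⟩
  refine ⟨Finset.univ.filter r, fun u hu => (Finset.mem_filter.1 hu).2.1, ?_, ?_⟩
  · rw [Finset.disjoint_left]
    intro u hu hmem
    obtain ⟨-, -, huW, huZ, b, hb⟩ := Finset.mem_filter.1 hu
    simp only [Finset.mem_union, huW, huZ, false_or, or_false] at hmem
    exact h.not_activeWalk hG hWY hmem hb
  · intro k hk hkR j hj
    have hjA : j ∈ A := by
      rcases mem_scope.1 hj with rfl | hj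
      · exact hk
      · exact ancestralSet_of_adj hj hk
    by_cases hjW : j ∈ W
    · simp [hjW]
    by_cases hjZ : j ∈ Z
    · simp [hjZ]
    suffices ∃ b, ActiveWalk G W Z A b j by
      simp only [Finset.mem_union, Finset.mem_filter, Finset.mem_univ, true_and]
      exact .inl (.inl ⟨hjA, hjW, hjZ, this⟩)
    rcases hkR with hkW | hkR
    · rcases mem_scope.1 hj with rfl | hj
      · exact absurd hkW hjW
      · exact ⟨k, .base hkW hj⟩
    · obtain ⟨u, hu, hur⟩ := Finset.not_disjoint_iff.1 hkR
      replace hur := (Finset.mem_filter.1 hur).2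
      by_cases huj : u = j
      · subst huj
        exact hur.2.2.2
      rcases mem_scope.1 hu with rfl | hu <;> rcases mem_scope.1 hj with rfl | hj
      · exact absurd rfl huj
      · exact ⟨u, hadj hur (.inl hj)⟩
      · exact ⟨u, hadj hur (.inr hu)⟩
      -- Two parents of k are joined through the collider k, open because k ∈ A even if k ∈ W ∪ Z.
      · exact ⟨k, (hadj hur (.inr hu)).step (.inl hj)
          ⟨fun _ => hk, fun hn => absurd ⟨hu, hj⟩ hn⟩⟩

end Graph

/-! ### Marginal integrals and null sets -/

section Marginal

theorem dependsOn_finset_prod {δ ι M : Type*} {X : δ → Type*} [CommMonoid M] {K : Finset ι}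
    {q : ι → (∀ i, X i) → M} {S : Set δ} (h : ∀ k ∈ K, DependsOn (q k) S) :
    DependsOn (fun x => ∏ k ∈ K, q k x) S :=
  fun _ _ hxy => Finset.prod_congr rfl fun k hk => h k hk hxy

theorem apply_updateFinset_of_dependsOn {δ β : Type*} [DecidableEq δ] {X : δ → Type*}
    {s : Finset δ} {f : (∀ i, X i) → β} {S : Set δ} (hf : DependsOn f S) (hS : ∀ i ∈ s, i ∉ S)
    (x : ∀ i, X i) (y : ∀ i : s, X i) : f (Function.updateFinset x s y) = f x :=
  hf fun i hi => by
    have : i ∉ s := fun h => hS i h hi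
    simp [Function.updateFinset, this]

variable {δ : Type*} [DecidableEq δ] {X : δ → Type*} [∀ i, MeasurableSpace (X i)]
  {μ : ∀ i, Measure (X i)} {s : Finset δ}

theorem dependsOn_lmarginal {f : (∀ i, X i) → ℝ≥0∞} {S : Set δ} (hf : DependsOn f S) :
    DependsOn (lmarginal μ s f) (S \ s) := by
  intro x y hxy
  refine lintegral_congr fun z => hf fun i hi => ?_
  by_cases his : i ∈ s
  · simp [Function.updateFinset, his]
  · simpa [Function.updateFinset, his] using hxy i ⟨hi, his⟩

/-- The factor `a` is constant along the integration, so it needs no measurability. -/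
theorem lmarginal_mul_of_dependsOn {a b : (∀ i, X i) → ℝ≥0∞} {S : Set δ} (ha : DependsOn a S)
    (hS : ∀ i ∈ s, i ∉ S) (hb : Measurable b) :
    lmarginal μ s (fun x => a x * b x) = fun x => a x * lmarginal μ s b x := by
  ext x
  simp only [lmarginal, apply_updateFinset_of_dependsOn ha hS]
  exact lintegral_const_mul (a x) (f := fun y => b (Function.updateFinset x s y))
    (hb.comp measurable_updateFinset)

theorem lmarginal_mul_of_dependsOn' {a b : (∀ i, X i) → ℝ≥0∞} {S : Set δ} (hb : DependsOn b S)
    (hS : ∀ i ∈ s, i ∉ S) (ha : Measurable a) :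
    lmarginal μ s (fun x => a x * b x) = fun x => lmarginal μ s a x * b x := by
  simp only [mul_comm _ (b _), lmarginal_mul_of_dependsOn hb hS ha]

theorem lmarginal_lmarginal_of_union_eq [∀ i, SigmaFinite (μ i)] {s t u : Finset δ}
    {f : (∀ i, X i) → ℝ≥0∞} (hf : Measurable f) (hst : Disjoint s t) (hu : s ∪ t = u) :
    lmarginal μ s (lmarginal μ t f) = lmarginal μ u f := by
  rw [← hu, lmarginal_union _ _ hf hst]

variable [Fintype δ] [∀ i, SigmaFinite (μ i)]

/-- A measurable property that holds for almost all values of the coordinates in `s`, whatever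
the other coordinates are, holds almost everywhere. -/
theorem ae_pi_of_forall_ae_updateFinset {p : (∀ i, X i) → Prop} (hp : MeasurableSet {x | p x})
    (h : ∀ x, ∀ᵐ y ∂Measure.pi (fun i : s => μ i), p (Function.updateFinset x s y)) :
    ∀ᵐ x ∂Measure.pi μ, p x := by
  rcases isEmpty_or_nonempty (∀ i, X i) with hX | ⟨⟨x⟩⟩
  · exact .of_forall fun x => hX.elim x
  have hm : Measurable ({x | p x}ᶜ.indicator (1 : (∀ i, X i) → ℝ≥0∞)) :=
    measurable_one.indicator hp.compl
  have h0 : lmarginal μ s ({x | p x}ᶜ.indicator 1) = fun _ => 0 := by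
    ext x
    refine (lintegral_congr_ae (g := 0) ?_).trans (by simp)
    filter_upwards [h x] with y hy
    simpa using hy
  have h1 := congrFun (lmarginal_lmarginal_of_union_eq (μ := μ) (s := sᶜ) hm disjoint_compl_left
    (Finset.union_comm _ _ |>.trans (Finset.union_compl s))) x
  rw [h0, lmarginal_univ, lintegral_indicator_one hp.compl] at h1
  exact h1.symm.trans (by simp [lmarginal])

/-- A property that holds almost everywhere still holds almost everywhere after the coordinates
in `s` have been redrawn. -/
theorem ae_ae_updateFinset {p : (∀ i, X i) → Prop} (h : ∀ᵐ x ∂Measure.pi μ, p x) :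
    ∀ᵐ x ∂Measure.pi μ, ∀ᵐ y ∂Measure.pi (fun i : s => μ i),
      p (Function.updateFinset x s y) := by
  -- Tonelli needs a measurable set, and `p` need not be measurable.
  obtain ⟨N, hpN, hN, hN0⟩ := exists_measurable_superset_of_null (ae_iff.1 h)
  have hm : Measurable (N.indicator (1 : (∀ i, X i) → ℝ≥0∞)) := measurable_one.indicator hN
  have key : ∀ᵐ x ∂Measure.pi μ, lmarginal μ s (N.indicator 1) x = 0 := by
    refine ae_pi_of_forall_ae_updateFinset (s := sᶜ)
      (measurableSet_eq_fun (hm.lmarginal μ) measurable_const) fun x => ?_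
    have h1 := congrFun (lmarginal_lmarginal_of_union_eq (μ := μ) (s := sᶜ) hm disjoint_compl_left
      (Finset.union_comm _ _ |>.trans (Finset.union_compl s))) x
    rw [lmarginal_univ, lintegral_indicator_one hN, hN0] at h1
    exact (lintegral_eq_zero_iff ((hm.lmarginal μ).comp measurable_updateFinset)).1 h1
  filter_upwards [key] with x hx
  filter_upwards [(lintegral_eq_zero_iff (hm.comp measurable_updateFinset)).1 hx] with y hy
  by_contra hp
  simp [Set.indicator_of_mem (hpN hp)] at hy

theorem lmarginal_congr_ae {f g : (∀ i, X i) → ℝ≥0∞} (h : f =ᵐ[Measure.pi μ] g) :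
    lmarginal μ s f =ᵐ[Measure.pi μ] lmarginal μ s g := by
  filter_upwards [ae_ae_updateFinset (s := s) h] with x hx
  exact lintegral_congr_ae hx

/-- A function vanishes almost everywhere on the zero set of its marginal. -/
theorem ae_eq_zero_of_lmarginal_eq_zero {f : (∀ i, X i) → ℝ≥0∞} (hf : Measurable f) :
    ∀ᵐ x ∂Measure.pi μ, lmarginal μ s f x = 0 → f x = 0 := by
  have hm := hf.lmarginal μ (s := s)
  refine ae_pi_of_forall_ae_updateFinset (s := s) ?_ fun x => ?_
  · exact (measurableSet_eq_fun hm measurable_const).imp (measurableSet_eq_fun hf measurable_const)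
  · have hd : ∀ y, lmarginal μ s f (Function.updateFinset x s y) = lmarginal μ s f x :=
      apply_updateFinset_of_dependsOn (dependsOn_lmarginal (dependsOn_univ f)) (by simp) x
    by_cases h0 : lmarginal μ s f x = 0
    · filter_upwards [(lintegral_eq_zero_iff (hf.comp measurable_updateFinset)).1 h0] with y hy _
      exact hy
    · exact .of_forall fun y hy => absurd ((hd y).symm.trans hy) h0

/-- The marginals of an integrable function are finite almost everywhere. -/
theorem ae_lmarginal_compl_lt_top {f : (∀ i, X i) → ℝ≥0∞} (hf : Measurable f)
    (h : ∫⁻ x, f x ∂Measure.pi μ ≠ ∞) : ∀ᵐ x ∂Measure.pi μ, lmarginal μ sᶜ f x < ∞ := by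
  have hm := hf.lmarginal μ (s := sᶜ)
  refine ae_pi_of_forall_ae_updateFinset (s := s) (measurableSet_lt hm measurable_const) fun x => ?_
  refine ae_lt_top (hm.comp measurable_updateFinset) ?_
  have h1 := congrFun (lmarginal_lmarginal_of_union_eq (μ := μ) (s := s) hf disjoint_compl_right
    (Finset.union_compl s)) x
  rw [lmarginal_univ] at h1
  exact h1.trans_ne h

end Marginal

/-! ### Integrating out the factors of a DAG -/

section Factorization

variable {V : Type*} [Fintype V] [DecidableEq V] {ν : V → Measure ℂ}
  {G : Digraph V} {q : V → (V → ℂ) → ℝ≥0∞}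

/-- A family of transition densities for the directed graph `G`. -/
structure IsKernelFamily (G : Digraph V) (ν : V → Measure ℂ) (q : V → (V → ℂ) → ℝ≥0∞) : Prop where
  measurable : ∀ k, Measurable (q k)
  dependsOn : ∀ k, DependsOn (q k) (({k} ∪ parents G k : Finset V) : Set V)
  normalized : ∀ k x, lmarginal ν {k} (q k) x = 1

theorem Factorizes.isKernelFamily {f : (V → ℂ) → ℝ≥0∞} (h : Factorizes G ν f q) :
    IsKernelFamily G ν q :=
  ⟨fun k => (h.isCondDensity k).measurable, fun k => (h.isCondDensity k).dependsOn,
    fun k => (h.isCondDensity k).normalized⟩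

theorem IsKernelFamily.measurable_prod (hq : IsKernelFamily G ν q) (K : Finset V) :
    Measurable fun x => ∏ k ∈ K, q k x :=
  Finset.measurable_prod _ fun k _ => hq.measurable k

/-- Integrating out a set `D` of nodes none of which is a parent of a node in `S` removes the
factors of `D` from the factorization. -/
theorem IsKernelFamily.lmarginal_prod [∀ i, SigmaFinite (ν i)] (hG : IsDAG G) (hq : IsKernelFamily G ν q) {S D : Finset V}
    (hSD : Disjoint S D) (hpa : ∀ k ∈ S, Disjoint (parents G k) D) :
    lmarginal ν D (fun x => ∏ k ∈ S ∪ D, q k x) = fun x => ∏ k ∈ S, q k x := by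
  induction hn : D.card generalizing D with
  | zero => simp [Finset.card_eq_zero.1 hn]
  | succ n ih =>
    have hne : D.Nonempty := Finset.card_pos.1 (by omega)
    have : IsTrans V (fun a b => Relation.TransGen G.Adj b a) := ⟨fun _ _ _ h h' => h'.trans h⟩
    have : Std.Irrefl (fun a b => Relation.TransGen G.Adj b a) := ⟨hG⟩
    -- Choose d ∈ D without descendants in D: then x_d occurs in the factor `q d` only, which
    -- integrates to one.
    obtain ⟨d, hd, hmin⟩ := (Finite.wellFounded_of_trans_of_irrefl
      (fun a b => Relation.TransGen G.Adj b a)).has_min (D : Set V) hne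
    have hdS : d ∉ S := Finset.disjoint_right.1 hSD hd
    have hdep : DependsOn (fun x => ∏ k ∈ S ∪ D.erase d, q k x) ({d}ᶜ : Set V) := by
      refine dependsOn_finset_prod fun k hk => (hq.dependsOn k).mono ?_
      intro j hj
      rintro rfl
      simp only [Finset.coe_union, Finset.coe_singleton, Set.mem_union, Set.mem_singleton_iff,
        Finset.mem_coe] at hj
      rcases hj with rfl | hj
      · simp [hdS] at hk
      · rcases Finset.mem_union.1 hk with hk | hk
        · exact Finset.disjoint_left.1 (hpa k hk) hj hd
        · exact hmin k (Finset.mem_of_mem_erase hk) (.single (by simpa [parents] using hj))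
    have hprod : (fun x => ∏ k ∈ S ∪ D, q k x) =
        fun x => (∏ k ∈ S ∪ D.erase d, q k x) * q d x := by
      ext x
      rw [mul_comm, ← Finset.prod_insert (f := fun k => q k x) (by simp [hdS]),
        ← Finset.union_insert, Finset.insert_erase hd]
    rw [← lmarginal_lmarginal_of_union_eq (hq.measurable_prod _) (s := D.erase d) (t := {d})
      (by simp) (by rw [Finset.union_comm, ← Finset.insert_eq, Finset.insert_erase hd]), hprod,
      lmarginal_mul_of_dependsOn hdep (by simp) (hq.measurable d)]
    simp only [hq.normalized, mul_one]
    exact ih (hSD.mono_right (Finset.erase_subset _ _))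
      (fun k hk => (hpa k hk).mono_right (Finset.erase_subset _ _))
      (by rw [Finset.card_erase_of_mem hd, hn]; rfl)

end Factorization

/-! ### The adjustment formula -/

section Backdoor

variable {V : Type*} [Fintype V] [DecidableEq V] {ν : V → Measure ℂ} [∀ i, SigmaFinite (ν i)]
  {G : Digraph V} {q : V → (V → ℂ) → ℝ≥0∞} {W Y Z : Finset V}

/-- Total mass one makes f(w,z) finite almost everywhere, as cancelling it in `ℝ≥0∞` requires. -/
theorem IsKernelFamily.lintegral_prod (hG : IsDAG G) (hq : IsKernelFamily G ν q) :
    ∫⁻ x, ∏ k, q k x ∂Measure.pi ν = 1 := by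
  have h := hq.lmarginal_prod hG (S := ∅) (D := Finset.univ) (by simp) (by simp)
  rw [lmarginal_univ] at h
  simpa using congrFun h 0

/-- An intervention on `W` does not change the density of the non-descendants `Z` of `W`. -/
theorem IsKernelFamily.lmarginal_interventionDensity (hG : IsDAG G) (hq : IsKernelFamily G ν q)
    (hWZ : Disjoint W Z) (hnd : ∀ w ∈ W, ∀ z ∈ Z, ¬ IsDescendant G w z) :
    lmarginal ν (W ∪ Z)ᶜ (interventionDensity q W) =
      marginalDensity ν (fun x => ∏ k, q k x) Z := by
  classical
  set A : Finset V := Finset.univ.filter (· ∈ ancestralSet G Z) with hA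
  have hmem : ∀ k, k ∈ A ↔ k ∈ ancestralSet G Z := by simp [hA]
  have hZA : Z ⊆ A := fun k hk => (hmem k).2 (subset_ancestralSet hk)
  have hAW : Disjoint A W := by
    rw [Finset.disjoint_right]
    intro w hw hwA
    obtain ⟨z, hz, hwz⟩ := (hmem w).1 hwA
    rcases Relation.reflTransGen_iff_eq_or_transGen.1 hwz with rfl | hwz
    · exact Finset.disjoint_left.1 hWZ hw hz
    · exact hnd w hw z hz hwz
  have hpa : ∀ k ∈ A, parents G k ⊆ A := fun k hk j hj =>
    (hmem j).2 (ancestralSet_of_adj (by simpa [parents] using hj) ((hmem k).1 hk))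
  have hpa' : ∀ D, Disjoint A D → ∀ k ∈ A, Disjoint (parents G k) D :=
    fun D hD k hk => hD.mono_left (hpa k hk)
  -- The ancestral set A of Z avoids W, so the full and the truncated product both reduce to the
  -- factors of A.
  have h1 := hq.lmarginal_prod hG (S := A) (D := Aᶜ) disjoint_compl_right
    (hpa' _ disjoint_compl_right)
  have h2 := hq.lmarginal_prod hG (S := A) (D := Wᶜ \ A) Finset.disjoint_sdiff
    (hpa' _ Finset.disjoint_sdiff)
  rw [Finset.union_compl] at h1
  rw [Finset.union_sdiff_of_subset (by rwa [Finset.subset_compl_iff_disjoint_right])] at h2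
  rw [marginalDensity, ← lmarginal_lmarginal_of_union_eq (s := A \ Z) (t := Aᶜ)
      (hq.measurable_prod _) ?_ ?_, h1,
    ← lmarginal_lmarginal_of_union_eq (f := interventionDensity q W) (s := A \ Z) (t := Wᶜ \ A)
      (hq.measurable_prod _) ?_ ?_]
  · exact congrArg _ h2
  · exact Finset.disjoint_sdiff.mono_left Finset.sdiff_subset
  · ext k
    have h3 : k ∈ Z → k ∈ A := @hZA k
    have h4 : k ∈ A → k ∉ W := fun h h' => Finset.disjoint_left.1 hAW h h'
    simp only [Finset.mem_union, Finset.mem_sdiff, Finset.mem_compl]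
    tauto
  · exact disjoint_compl_right.mono_left Finset.sdiff_subset
  · ext k
    have h3 : k ∈ Z → k ∈ A := @hZA k
    simp only [Finset.mem_union, Finset.mem_sdiff, Finset.mem_compl]
    tauto

/-- Under the back-door criterion, conditioning on `W` and intervening on `W` have the same effect
on `Y` given `Z`: `f(y, w, z) f(z ∣ do(w)) = f(w, z) f(y, z ∣ do(w))`. -/
theorem IsKernelFamily.backdoor_mul_eq (hG : IsDAG G) (hq : IsKernelFamily G ν q)
    (hWY : Disjoint W Y) (hYZ : Disjoint Y Z) (hZ : BackdoorCriterion G W Y Z) (x : V → ℂ) :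
    marginalDensity ν (fun x => ∏ k, q k x) (W ∪ Y ∪ Z) x *
        lmarginal ν (W ∪ Z)ᶜ (interventionDensity q W) x =
      marginalDensity ν (fun x => ∏ k, q k x) (W ∪ Z) x *
        lmarginal ν (W ∪ Y ∪ Z)ᶜ (interventionDensity q W) x := by
  classical
  set A : Finset V := Finset.univ.filter (· ∈ ancestralSet G (W ∪ Y ∪ Z)) with hA
  have hmem : ∀ k, k ∈ A ↔ k ∈ ancestralSet G (W ∪ Y ∪ Z) := by simp [hA]
  have hTA : W ∪ Y ∪ Z ⊆ A := fun k hk => (hmem k).2 (subset_ancestralSet hk)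
  have hWA : W ⊆ A := fun k hk => hTA (by simp [hk])
  have hpa : ∀ k ∈ A, parents G k ⊆ A := fun k hk j hj =>
    (hmem j).2 (ancestralSet_of_adj (by simpa [parents] using hj) ((hmem k).1 hk))
  have hpa' : ∀ k ∈ A, Disjoint (parents G k) Aᶜ :=
    fun k hk => disjoint_compl_right.mono_left (hpa k hk)
  obtain ⟨R, hRA, hRT, hR⟩ := hZ.exists_separation hG hWY
  replace hRA : R ⊆ A := fun u hu => (hmem u).2 (hRA u hu)
  set S := (A \ (W ∪ Y ∪ Z)) \ R with hS
  -- K collects the factors free of R, L those meeting R; the factors of W join L in the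
  -- observational density and are absent under intervention.
  set K : Finset V := (A \ W).filter fun k => Disjoint ({k} ∪ parents G k) R with hK
  set L : Finset V := (A \ W).filter fun k => ¬ Disjoint ({k} ∪ parents G k) R with hL
  set a : (V → ℂ) → ℝ≥0∞ := fun x => ∏ k ∈ K, q k x with ha
  set b : (V → ℂ) → ℝ≥0∞ := fun x => ∏ k ∈ L, q k x with hb
  set b' : (V → ℂ) → ℝ≥0∞ := fun x => ∏ k ∈ L ∪ W, q k x with hb'
  have hma : Measurable a := hq.measurable_prod K
  have hmb : Measurable b := hq.measurable_prod L
  have hmb' : Measurable b' := hq.measurable_prod _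
  have hda : DependsOn a ((R : Set V)ᶜ) := dependsOn_finset_prod fun k hk =>
    (hq.dependsOn k).mono fun j hj hjR =>
      Finset.disjoint_left.1 (Finset.mem_filter.1 hk).2 hj hjR
  have hscope : ∀ k ∈ L ∪ W, {k} ∪ parents G k ⊆ R ∪ W ∪ Z := by
    intro k hk
    rcases Finset.mem_union.1 hk with hk | hk
    · obtain ⟨hkA, hkR⟩ := Finset.mem_filter.1 hk
      exact hR k ((hmem k).1 (Finset.mem_sdiff.1 hkA).1) (.inr hkR)
    · exact hR k ((hmem k).1 (hWA hk)) (.inl hk)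
  have hdb : DependsOn b (R ∪ W ∪ Z : Finset V) := dependsOn_finset_prod fun k hk =>
    (hq.dependsOn k).mono (Finset.coe_subset.2 (hscope k (Finset.mem_union_left _ hk)))
  have hdb' : DependsOn b' (R ∪ W ∪ Z : Finset V) := dependsOn_finset_prod fun k hk =>
    (hq.dependsOn k).mono (Finset.coe_subset.2 (hscope k hk))
  have hKL : ∀ x, ∏ k ∈ A \ W, q k x = a x * b x := fun x =>
    (Finset.prod_filter_mul_prod_filter_not _ _ _).symm
  have hLW : Disjoint L W := Finset.sdiff_disjoint.mono_left (Finset.filter_subset _ _)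
  have hKLW : ∀ x, ∏ k ∈ A, q k x = a x * b' x := fun x => by
    simp only [hb']
    rw [Finset.prod_union hLW, ← mul_assoc, ← hKL, Finset.prod_sdiff hWA]
  -- the marginals of `a * c` when `c` only depends on `R ∪ W ∪ Z`
  have hfactor : ∀ c : (V → ℂ) → ℝ≥0∞, Measurable c → DependsOn c (R ∪ W ∪ Z : Finset V) →
      lmarginal ν (A \ (W ∪ Y ∪ Z)) (fun x => a x * c x) =
        (fun x => lmarginal ν S a x * lmarginal ν R c x) ∧
      lmarginal ν (A \ (W ∪ Z)) (fun x => a x * c x) =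
        (fun x => lmarginal ν Y (lmarginal ν S a) x * lmarginal ν R c x) := by
    intro c hc hdc
    have hdc' := dependsOn_lmarginal (μ := ν) (s := R) hdc
    have h1 : lmarginal ν (A \ (W ∪ Y ∪ Z)) (fun x => a x * c x) =
        fun x => lmarginal ν S a x * lmarginal ν R c x := by
      rw [← lmarginal_lmarginal_of_union_eq (f := fun x => a x * c x) (s := S) (t := R) (hma.mul hc)
          Finset.sdiff_disjoint (Finset.sdiff_union_of_subset (Finset.subset_sdiff.2 ⟨hRA, hRT⟩)),
        lmarginal_mul_of_dependsOn hda (by simp) hc, lmarginal_mul_of_dependsOn' hdc' ?_ hma]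
      intro i hi
      simp only [hS, Finset.mem_sdiff, Finset.mem_union, not_or] at hi
      simp [hi]
    refine ⟨h1, ?_⟩
    rw [← lmarginal_lmarginal_of_union_eq (f := fun x => a x * c x) (s := Y)
        (t := A \ (W ∪ Y ∪ Z)) (hma.mul hc) ?_ ?_, h1,
      lmarginal_mul_of_dependsOn' hdc' ?_ (hma.lmarginal ν)]
    · intro i hi
      have h2 : i ∉ W := fun h => Finset.disjoint_left.1 hWY h hi
      have h3 : i ∉ Z := Finset.disjoint_left.1 hYZ hi
      simp +contextual [h2, h3]
    · refine Finset.disjoint_sdiff.mono_left fun i hi => ?_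
      simp [hi]
    · ext i
      have h2 : i ∈ Y → i ∉ W := fun h h' => Finset.disjoint_left.1 hWY h' h
      have h3 : i ∈ Y → i ∉ Z := fun h => Finset.disjoint_left.1 hYZ h
      have h4 : i ∈ Y → i ∈ A := fun h => hTA (by simp [h])
      simp only [Finset.mem_union, Finset.mem_sdiff]
      tauto
  have hU : ∀ {U : Finset V}, U ⊆ A → (A \ U) ∪ Aᶜ = Uᶜ := by
    intro U hU
    ext i
    have := @hU i
    simp only [Finset.mem_union, Finset.mem_sdiff, Finset.mem_compl]
    tauto
  have hWZA : W ∪ Z ⊆ A := fun i hi => hTA (by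
    simp only [Finset.mem_union] at hi ⊢
    tauto)
  have hobs : ∀ U ⊆ A, marginalDensity ν (fun x => ∏ k, q k x) U =
      lmarginal ν (A \ U) (fun x => a x * b' x) := by
    intro U hUA
    have h := hq.lmarginal_prod hG (S := A) (D := Aᶜ) disjoint_compl_right hpa'
    rw [Finset.union_compl] at h
    rw [marginalDensity, ← lmarginal_lmarginal_of_union_eq (s := A \ U) (t := Aᶜ)
      (hq.measurable_prod _) (disjoint_compl_right.mono_left Finset.sdiff_subset) (hU hUA), h]
    simp only [hKLW]
  have hdo : ∀ U ⊆ A, lmarginal ν Uᶜ (interventionDensity q W) =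
      lmarginal ν (A \ U) (fun x => a x * b x) := by
    intro U hUA
    have h := hq.lmarginal_prod hG (S := A \ W) (D := Aᶜ)
      (disjoint_compl_right.mono_left Finset.sdiff_subset)
      fun k hk => hpa' k (Finset.mem_sdiff.1 hk).1
    rw [hU hWA] at h
    rw [← lmarginal_lmarginal_of_union_eq (f := interventionDensity q W) (s := A \ U) (t := Aᶜ)
      (hq.measurable_prod _) (disjoint_compl_right.mono_left Finset.sdiff_subset) (hU hUA)]
    refine congrArg _ (h.trans ?_)
    simp only [hKL]
  -- Both sides become the product of ∫ a over S, its integral over Y, and the integrals of b and b'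
  -- over R.
  rw [hobs _ hTA, hobs _ hWZA, hdo _ hTA, hdo _ hWZA, (hfactor b hmb hdb).1, (hfactor b hmb hdb).2,
    (hfactor b' hmb' hdb').1, (hfactor b' hmb' hdb').2]
  ring

/-- The adjustment formula, for observed densities that are those of the factorization `∏ k, q k`. -/
theorem IsKernelFamily.backdoor_adjustment (hG : IsDAG G) (hq : IsKernelFamily G ν q)
    (hWY : Disjoint W Y) (hWZ : Disjoint W Z) (hYZ : Disjoint Y Z)
    (hZ : BackdoorCriterion G W Y Z) {f : (V → ℂ) → ℝ≥0∞} (hf : Measurable f)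
    (hfq : marginalDensity ν (fun x => ∏ k, q k x) (W ∪ Y ∪ Z) =ᵐ[Measure.pi ν]
      marginalDensity ν f (W ∪ Y ∪ Z)) :
    ∀ᵐ x ∂Measure.pi ν, Positivity ν f W Z x →
      doDensity ν q W Y x =
        lmarginal ν Z
          (fun x' => condDensity ν f Y (W ∪ Z) x' * marginalDensity ν f Z x') x := by
  set h : (V → ℂ) → ℝ≥0∞ := fun x => ∏ k, q k x with hh
  have hmh : Measurable h := hq.measurable_prod _
  have hmg : Measurable (interventionDensity q W) := hq.measurable_prod _
  have hsub : ∀ U ⊆ W ∪ Y ∪ Z, marginalDensity ν h U =ᵐ[Measure.pi ν] marginalDensity ν f U := by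
    intro U hU
    have key : ∀ {k : (V → ℂ) → ℝ≥0∞}, Measurable k → marginalDensity ν k U =
        lmarginal ν ((W ∪ Y ∪ Z) \ U) (marginalDensity ν k (W ∪ Y ∪ Z)) := by
      intro k hk
      refine (lmarginal_lmarginal_of_union_eq hk
        (disjoint_compl_right.mono_left Finset.sdiff_subset) ?_).symm
      ext i
      have := @hU i
      simp only [Finset.mem_union, Finset.mem_sdiff, Finset.mem_compl] at this ⊢
      tauto
    rw [key hmh, key hf]
    exact lmarginal_congr_ae hfq
  have hWYZ : Y ∪ (W ∪ Z) = W ∪ Y ∪ Z := by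
    rw [← Finset.union_assoc, Finset.union_comm Y W]
  have hdoZ := hq.lmarginal_interventionDensity hG hWZ hZ.not_descendant
  have hfin := ae_lmarginal_compl_lt_top (s := W ∪ Z) hmh
    (by rw [hh, hq.lintegral_prod hG]; exact ENNReal.one_ne_top)
  -- The Y-marginal of f(y,z ∣ do(w)) is f(z ∣ do(w)) = f(z); where f(z) = 0, no positivity of
  -- f(w,z) is available, but f(y,z ∣ do(w)) vanishes almost everywhere.
  have hzero := ae_eq_zero_of_lmarginal_eq_zero (μ := ν) (s := Y)
    (hmg.lmarginal ν (s := (W ∪ Y ∪ Z)ᶜ))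
  rw [lmarginal_lmarginal_of_union_eq (u := (W ∪ Z)ᶜ) hmg, hdoZ] at hzero
  rotate_left
  · exact disjoint_compl_right.mono_left fun i hi => by simp [hi]
  · ext i
    have h2 : i ∈ Y → i ∉ W := fun h h' => Finset.disjoint_left.1 hWY h' h
    have h3 : i ∈ Y → i ∉ Z := fun h => Finset.disjoint_left.1 hYZ h
    simp only [Finset.mem_union, Finset.mem_compl]
    tauto
  have hall := ((hsub Z Finset.subset_union_right).and (hsub (W ∪ Z) (by
    intro i hi
    simp only [Finset.mem_union] at hi ⊢
    tauto))).and (hfq.and (hfin.and hzero))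
  -- The formula integrates over z with the other coordinates fixed, so the almost sure facts are
  -- needed for almost every z at almost every x.
  filter_upwards [ae_ae_updateFinset (s := Z) hall] with x hx hpos
  rw [doDensity, ← lmarginal_lmarginal_of_union_eq (s := Z) (t := (W ∪ Y ∪ Z)ᶜ) hmg
    (disjoint_compl_right.mono_left Finset.subset_union_right)]
  swap
  · ext i
    have h2 : i ∈ Z → i ∉ W := fun h h' => Finset.disjoint_left.1 hWZ h' h
    have h3 : i ∈ Z → i ∉ Y := fun h h' => Finset.disjoint_left.1 hYZ h' h
    simp only [Finset.mem_union, Finset.mem_compl]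
    tauto
  refine lintegral_congr_ae ?_
  filter_upwards [hx, hpos] with z ⟨⟨h1, h2⟩, h3, h4, h5⟩ hp
  have hmul := hq.backdoor_mul_eq hG hWY hYZ hZ (ν := ν) (Function.updateFinset x Z z)
  rw [hdoZ] at hmul
  rw [condDensity, hWYZ, ← h1, ← h2, ← h3]
  rw [← h1, ← h2] at hp
  rcases eq_or_ne (marginalDensity ν h Z (Function.updateFinset x Z z)) 0 with h0 | h0
  · rw [h0, mul_zero]
    exact h5 h0
  · have hp' := hp (pos_iff_ne_zero.2 h0)
    rw [ENNReal.mul_comm_div, ← mul_div_assoc, hmul, mul_comm,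
      ENNReal.mul_div_cancel_right hp'.ne' h4.ne]

end Backdoor

end FreqBackdoor

theorem mainTheorem4
    {V : Type*} [Fintype V] [DecidableEq V]
    {Θ : Type*} [MeasurableSpace Θ] (P : MeasureTheory.Measure Θ)
    [MeasureTheory.IsProbabilityMeasure P]
    -- the stochastic processes, with absolutely summable sample paths
    (I : Set ℤ) (X : V → I → Θ → ℝ)
    (hX : ∀ i t, Measurable (X i t))
    (hX_summable : ∀ i θ, Summable fun t => |X i t θ|)
    -- the frequency, and the density of the Fourier components there
    (ω : ℝ) (_hω : ω ∈ Set.Icc 0 (2 * Real.pi))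
    (ν : V → MeasureTheory.Measure ℂ) [∀ i, MeasureTheory.SigmaFinite (ν i)]
    (f : (V → ℂ) → ENNReal)
    (hf : P.map (fun θ i => FreqBackdoor.fourierComponent (X i) ω θ) =
      (MeasureTheory.Measure.pi ν).withDensity f)
    -- the DAG according to which the density factorizes
    (G : Digraph V) (hG : FreqBackdoor.IsDAG G)
    (q : V → (V → ℂ) → ENNReal) (hq : FreqBackdoor.Factorizes G ν f q)
    (W Y Z : Finset V) (hWY : Disjoint W Y) (hWZ : Disjoint W Z) (hYZ : Disjoint Y Z)
    (hZ : FreqBackdoor.BackdoorCriterion G W Y Z) :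
    FreqBackdoor.Identifiable G ν f (W ∪ Y ∪ Z) W Y (FreqBackdoor.Positivity ν f W Z) ∧
    ∀ᵐ x ∂MeasureTheory.Measure.pi ν, FreqBackdoor.Positivity ν f W Z x →
      FreqBackdoor.doDensity ν q W Y x =
        MeasureTheory.lmarginal ν Z
          (fun x' => FreqBackdoor.condDensity ν f Y (W ∪ Z) x' *
            FreqBackdoor.marginalDensity ν f Z x') x := by
  -- The right side is built from `f` for every compatible model, so two models have equal effects
  -- at once.
  have key : ∀ {f' q'}, FreqBackdoor.Factorizes G ν f' q' →
      FreqBackdoor.marginalDensity ν f' (W ∪ Y ∪ Z) =ᵐ[Measure.pi ν]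
        FreqBackdoor.marginalDensity ν f (W ∪ Y ∪ Z) →
      ∀ᵐ x ∂Measure.pi ν, FreqBackdoor.Positivity ν f W Z x →
        FreqBackdoor.doDensity ν q' W Y x = lmarginal ν Z
          (fun x' => FreqBackdoor.condDensity ν f Y (W ∪ Z) x' *
            FreqBackdoor.marginalDensity ν f Z x') x := fun h' hf' =>
    h'.isKernelFamily.backdoor_adjustment hG hWY hWZ hYZ hZ hq.measurable
      ((FreqBackdoor.lmarginal_congr_ae (h'.factorization.mono fun _ => Eq.symm)).trans hf')
  refine ⟨fun f₁ f₂ q₁ q₂ h₁ h₂ hf₁ hf₂ => ?_, key hq .rfl⟩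
  filter_upwards [key h₁ hf₁, key h₂ hf₂] with x hx₁ hx₂ hx
  rw [hx₁ hx, hx₂ hx]
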